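/- **Setting.** A library has $N\ge 1$ files of $F$ packets each. There are $K_T$ transmitters and $K_R$ receivers with caches of $M_TF$ and $M_RF$ packets. Receiver $j$ observes $y_j=\sum_i h_{ji}s_i+n_j$ with a fixed, globally known channel matrix $h\in\mathbb C^{K_R\times K_T}$. Given caches $\mathcal C^T_i,\mathcal C^R_j$ and a demand vector $d$ (receiver $j$ wants file $d_j$), a *one-shot linear delivery scheme* consists of $H\ge1$ blocks. In block $m$ each receiver of some set is served one packet of its demanded file that it has not cached, different receivers being served different packets. Transmitter $i$ sends a linear combination of the coded versions $\hat w\in\mathbb C^{\hat L}$ of those served packets that it has cached. Each served receiver must have a linear combination of $y_j$ and its cached coded packets that equals its desired coded packet plus $n_j$, for all values of the coded packets and of the noise. Over the $H$ blocks every receiver must be served all packets of its demanded file that it has not cached. The sum-DoF of the scheme is the number of delivered requests (pairs of a receiver and a packet demanded by it) divided by $H$. The one-shot linear sum-DoF of a placement is the infimum over $d$ of the supremum over delivery schemes of the sum-DoF. *Hypercube placement.* Let $D_T=N/M_T$ and $D_R=N/M_R$ be positive integers, $K_T=D_Tt_T$, $K_R=D_Rt_R$, and group the transmitters (receivers) into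 dimensions $\mathcal U^T_i=\{k:\lfloor k/D_T\rfloor=i\}$, $0\le i<t_T$ (resp. $\mathcal U^R_i=\{k:\lfloor k/D_R\rfloor=i\}$, $0\le i<t_R$). Each file is partitioned into $D_T^{t_T}D_R^{t_R}$ subfiles of equal size, indexed by $(\mathcal T,\mathcal R)\in\prod_i\mathcal U^T_i\times\prod_i\mathcal U^R_i$; a transmitter caches exactly the subfiles whose $\mathcal T$ contains it, a receiver exactly those whose $\mathcal R$ contains it. **Theorem 1.** Assume that $\delta=t_T/t_R$ is a positive integer ($t_R\geq 1$), $D_R=K_R/t_R\ge\delta+1$, and $K_R\ge (K_TM_T+K_RM_R)/N$. Then $(K_TM_T+K_RM_R)/N=t_T+t_R$, and $$F=\Big(\frac{N}{M_T}\Big)^{t_T}\Big(\frac{N}{M_R}\Big)^{t_R}\binom{D_R-2}{\delta-1}\binom{D_R-1}{\delta}^{t_R-1}\frac{(\delta!)^{t_R}}{\delta}(t_R-1)!$$ is an integer. For this $F$ hypercube placements exist, and every hypercube placement satisfies the memory constraints and has the following property. For Lebesgue-almost every channel matrix $h$ and for every demand vector there is a one-shot linear delivery scheme with sum-DoF exactly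 $(K_TM_T+K_RM_R)/N$; in particular, for almost every $h$ the one-shot linear sum-DoF of the placement is at least $(K_TM_T+K_RM_R)/N$. Moreover, the scheme can be chosen so that in each block the served receivers are $\delta+1$ receivers of each dimension $\mathcal U^R_i$, $t_T+t_R$ in total, placed around a table as a circular hypercube permutation (the positions of any two of them in the same dimension differ by $kt_R$ for some integer $1\le k\le\delta$). The packet served to a receiver is cached by the $t_R$ receivers that follow it around the table. At the remaining $t_T-1$ served receivers the packet is not cached, and there the transmitters caching it zero-force its signal. -/

import Mathlib

open MeasureTheory
open scoped ENNReal Nat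

/-- A packet of the library: `(n, p)` is packet `p` of file `n`
(there are `N` files with `F` packets each). -/
abbrev Packet (N F : ℕ) : Type := Fin N × Fin F

/-- A caching realization: which packets each transmitter and each receiver stores. -/
structure CachePlacement (KT KR N F : ℕ) where
  /-- packets cached by each transmitter -/
  tx : Fin KT → Finset (Packet N F)
  /-- packets cached by each receiver -/
  rx : Fin KR → Finset (Packet N F)

/-- The memory constraints: at most `MT * F` packets at each transmitter and at most
`MR * F` packets at each receiver. -/
def CachePlacement.MemoryFeasible {KT KR N F : ℕ} (C : CachePlacement KT KR N F)
    (MT MR : ℝ) : Prop :=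
  (∀ i, ((C.tx i).card : ℝ) ≤ MT * F) ∧ (∀ j, ((C.rx j).card : ℝ) ≤ MR * F)

/-- The nodes `0, …, K - 1` are grouped into dimensions `U_i = {k | ⌊k / D⌋ = i}`, `i < t`.
An element of `LatticePoint K D t` is an element of `U_0 × ⋯ × U_{t-1}`. -/
abbrev LatticePoint (K D t : ℕ) : Type := (i : Fin t) → {k : Fin K // (k : ℕ) / D = (i : ℕ)}

/-- Hypercube cache placement: every file is partitioned into equal-size subfiles indexed by
pairs `(τ, ρ)` of lattice points (for packet `p` of file `n`, `sub n p` is the index of the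
subfile that contains it; each subfile consists of `F / (DT ^ tT * DR ^ tR)` packets); a
transmitter caches exactly the subfiles with the transmitter in `τ`, a receiver exactly
those with the receiver in `ρ`. -/
def CachePlacement.IsHypercube {KT KR N F : ℕ} (C : CachePlacement KT KR N F)
    (DT tT DR tR : ℕ) : Prop :=
  ∃ sub : Fin N → Fin F → LatticePoint KT DT tT × LatticePoint KR DR tR,
    (∀ n s, (Finset.univ.filter fun p => sub n p = s).card * (DT ^ tT * DR ^ tR) = F) ∧
    (∀ i w, w ∈ C.tx i ↔ ∃ a, ((sub w.1 w.2).1 a : Fin KT) = i) ∧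
    (∀ j w, w ∈ C.rx j ↔ ∃ a, ((sub w.1 w.2).2 a : Fin KR) = j)

/-- The requested packets of a block, given the demand vector and the set of pairs
(receiver, index of the packet of its demanded file that it is served). -/
def blockPackets {KR N F : ℕ} (d : Fin KR → Fin N) (req : Finset (Fin KR × Fin F)) :
    Finset (Packet N F) :=
  req.image fun r => (d r.1, r.2)

/-- The block of symbols sent by transmitter `i`: a linear combination, with coefficients
`coef i`, of those coded packets in `P` that the transmitter has cached. -/
def txSignal {KT KR N F l : ℕ} (C : CachePlacement KT KR N F) (P : Finset (Packet N F))
    (coef : Fin KT → Packet N F → ℂ) (coded : Packet N F → Fin l → ℂ) (i : Fin KT) :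
    Fin l → ℂ :=
  ∑ w ∈ C.tx i ∩ P, coef i w • coded w

/-- The block of symbols received by receiver `j` over the channel `h`, with noise `noise`. -/
def rxSignal {KT KR N F l : ℕ} (h : Fin KR → Fin KT → ℂ) (C : CachePlacement KT KR N F)
    (P : Finset (Packet N F)) (coef : Fin KT → Packet N F → ℂ)
    (coded : Packet N F → Fin l → ℂ) (noise : Fin l → ℂ) (j : Fin KR) : Fin l → ℂ :=
  ∑ i, h j i • txSignal C P coef coded i + noise

/-- A one-shot linear delivery scheme for the channel `h`, the caches `C` and the demand
vector `d`: it delivers to every receiver all packets of its demanded file that the receiver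
has not cached. -/
structure DeliveryScheme {KT KR N F : ℕ} (h : Fin KR → Fin KT → ℂ)
    (C : CachePlacement KT KR N F) (d : Fin KR → Fin N) where
  /-- number of blocks -/
  H : ℕ
  H_pos : 0 < H
  /-- `(j, p) ∈ req m`: in block `m`, receiver `j` is served packet `p` of file `d j` -/
  req : Fin H → Finset (Fin KR × Fin F)
  /-- `coef m i w`: coefficient used by transmitter `i` for packet `w` in block `m` -/
  coef : Fin H → Fin KT → Packet N F → ℂ
  /-- only packets that the receiver has not cached are served -/
  req_uncached : ∀ m, ∀ r ∈ req m, (d r.1, r.2) ∉ C.rx r.1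
  /-- in one block a receiver is served one packet -/
  receiver_inj : ∀ m, ∀ r ∈ req m, ∀ r' ∈ req m, r.1 = r'.1 → r = r'
  /-- in one block a packet is intended for one receiver -/
  packet_inj : ∀ m, ∀ r ∈ req m, ∀ r' ∈ req m, (d r.1, r.2) = (d r'.1, r'.2) → r = r'
  /-- each served receiver has a linear combination of the signal received in the block and
  of its cached coded packets that equals the desired coded packet plus noise, whatever the
  coded packets and the noise are -/
  decodable : ∀ m, ∀ r ∈ req m, ∃ (a : ℂ) (b : Packet N F → ℂ),
    ∀ (l : ℕ) (coded : Packet N F → Fin l → ℂ) (noise : Fin l → ℂ),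
      a • rxSignal h C (blockPackets d (req m)) (coef m) coded noise r.1
        + ∑ w ∈ C.rx r.1, b w • coded w = coded (d r.1, r.2) + noise
  /-- all demands are satisfied -/
  complete : ∀ j p, (d j, p) ∉ C.rx j → ∃ m, (j, p) ∈ req m

/-- The sum-DoF of a delivery scheme: number of delivered requests (pairs of a receiver and a
packet demanded by it) per block. -/
noncomputable def DeliveryScheme.sumDoF {KT KR N F : ℕ} {h : Fin KR → Fin KT → ℂ}
    {C : CachePlacement KT KR N F} {d : Fin KR → Fin N} (S : DeliveryScheme h C d) : ℝ :=
  ((Finset.univ.biUnion S.req).card : ℝ) / (S.H : ℝ)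

/-- The one-shot linear sum-DoF of a caching realization: worst case over the demands of the
best sum-DoF of a delivery scheme. -/
noncomputable def oneShotLinearSumDoF {KT KR N F : ℕ} (h : Fin KR → Fin KT → ℂ)
    (C : CachePlacement KT KR N F) : ℝ≥0∞ :=
  ⨅ d : Fin KR → Fin N, ⨆ S : DeliveryScheme h C d, ENNReal.ofReal S.sumDoF

/-- A hypercube permutation (in dimensions `U_i = {k | ⌊k / DR⌋ = i}`, `i < t`) of a set of
nodes with `q` nodes in each of the `t` dimensions: the positions of two nodes of the same
dimension differ by `k * t` with `1 ≤ k ≤ q - 1`. -/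
def IsHypercubePermutation {K n : ℕ} (DR t q : ℕ) (π : Fin n → Fin K) : Prop :=
  Function.Injective π ∧
  (∀ i < t, (Finset.univ.filter fun x => (π x : ℕ) / DR = i).card = q) ∧
  ∀ x y, x ≠ y → (π x : ℕ) / DR = (π y : ℕ) / DR →
    ∃ k : ℕ, 1 ≤ k ∧ k ≤ q - 1 ∧ ((x : ℤ) - (y : ℤ)).natAbs = k * t

/-- The position `k` steps after `x` around a table with `n` places. -/
def stepAround {n : ℕ} (x : Fin n) (k : ℕ) : Fin n := ⟨(x + k) % n, Nat.mod_lt _ x.pos⟩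

/-- Every block is scheduled by a circular hypercube permutation of `tT + tR` receivers: one
packet goes to each of them; this packet is cached by the `tR` receivers that follow around
the table, and it is not cached, but zero-forced by the transmitters that cache it, at the
remaining `tT - 1` receivers. -/
def DeliveryScheme.IsCircularHypercube {KT KR N F : ℕ} {h : Fin KR → Fin KT → ℂ}
    {C : CachePlacement KT KR N F} {d : Fin KR → Fin N} (S : DeliveryScheme h C d)
    (DR tT tR δ : ℕ) : Prop :=
  ∀ m, ∃ (π : Fin (tT + tR) → Fin KR) (pkt : Fin (tT + tR) → Fin F),
    IsHypercubePermutation DR tR (δ + 1) π ∧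
    S.req m = Finset.univ.image (fun x => (π x, pkt x)) ∧
    ∀ x k,
      (1 ≤ k → k ≤ tR → (d (π x), pkt x) ∈ C.rx (π (stepAround x k))) ∧
      (tR < k → k < tT + tR →
        (d (π x), pkt x) ∉ C.rx (π (stepAround x k)) ∧
        ∑ i with (d (π x), pkt x) ∈ C.tx i,
          h (π (stepAround x k)) i * S.coef m i (d (π x), pkt x) = 0)

/-! Fix a transmitter index `τ`. A seating puts `δ * t + t` distinct receivers around a table so
that two of them share a dimension exactly when their places agree modulo `t`. The `t` receivers
after place `0` then form a lattice point `ρ`. If `j` sits at place `0`, it lies outside `ρ`, so `j`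
lacks the subfile `(τ, ρ)`. The subfile size is exactly the number of seatings with given `j` and
`ρ` (`card_tableOrder_follows`). Hence the packets that `j` lacks in the subfiles with first index
`τ` can be labelled bijectively by the seatings starting at `j` (`exists_labelling`).

A block is a pair of `τ` and a rotation class of seatings: the receiver at place `x` gets the packet
labelled by the seating read from `x`. Every missing packet carries one label, hence occurs in
exactly one block, and each block serves `δ * t + t` requests. The sum-DoF is therefore `δ * t + t`.

Within a block the next `t` receivers cache the packet and cancel it. Gain one at the intended
receiver and gain zero at the other `δ * t - 1` receivers are `δ * t` linear equations in the
coefficients of the `δ * t` transmitters of `τ`. They are solvable when the corresponding square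
submatrix of `h` is invertible, which holds for all such submatrices at once for almost every `h`
(`ae_submatrix_det_ne_zero`, `exists_zeroForcing`). -/

/-! ### Generic channels and zero-forcing -/

/-- For almost every matrix, all square submatrices of a given size are invertible. -/
theorem ae_submatrix_det_ne_zero (n KR KT : ℕ) :
    ∀ᵐ h : Fin KR → Fin KT → ℂ, ∀ (e : Fin n ↪ Fin KR) (f : Fin n ↪ Fin KT),
      (Matrix.of fun a b => h (e a) (f b)).det ≠ 0 := by
  rw [ae_all_iff]
  intro e
  rw [ae_all_iff]
  intro f
  classical
  -- The line of matrices along which the chosen submatrix moves by `t • 1`.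
  let L : ℂ →ₗ[ℝ] (Fin KR → Fin KT → ℂ) :=
    { toFun := fun t j i => if ∃ a, e a = j ∧ f a = i then t else 0
      map_add' := fun s t => by
        funext j i
        simp only [Pi.add_apply]
        split_ifs <;> simp
      map_smul' := fun s t => by
        funext j i
        simp only [Pi.smul_apply, RingHom.id_apply]
        split_ifs <;> simp }
  have hcont : Continuous fun h : Fin KR → Fin KT → ℂ =>
      (Matrix.of fun a b => h (e a) (f b)).det := by
    apply Continuous.matrix_det
    refine continuous_matrix fun a b => ?_
    simp only [Matrix.of_apply]
    fun_prop
  have hs : MeasurableSet {h : Fin KR → Fin KT → ℂ |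
      (Matrix.of fun a b => h (e a) (f b)).det ≠ 0} :=
    (isOpen_ne.preimage hcont).measurableSet
  have hhaar : (volume : Measure (Fin KR → Fin KT → ℂ)).IsAddHaarMeasure := by
    have : (volume : Measure (Fin KT → ℂ)).IsAddHaarMeasure :=
      Measure.pi.isAddHaarMeasure (fun _ => (volume : Measure ℂ))
    exact Measure.pi.isAddHaarMeasure (fun _ => (volume : Measure (Fin KT → ℂ)))
  -- By Fubini it is enough that each translate `y + L t` is good for almost every `t`. Its
  -- determinant is the characteristic polynomial of `-A` at `t`, which has finitely many roots.
  refine ae_mem_of_ae_add_linearMap_mem L volume volume hs fun y => ?_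
  set A : Matrix (Fin n) (Fin n) ℂ := Matrix.of fun a b => y (e a) (f b) with hA
  have hfin : {t : ℂ | (-A).charpoly.IsRoot t}.Finite :=
    Polynomial.finite_setOfPred_isRoot (Matrix.charpoly_monic _).ne_zero
  filter_upwards [hfin.countable.ae_notMem volume] with t ht hdet
  apply ht
  change (-A).charpoly.eval t = 0
  rw [Matrix.eval_charpoly, ← hdet]
  congr 1
  ext a b
  simp only [L, hA, Matrix.scalar_apply, Matrix.sub_apply, Matrix.neg_apply, Matrix.of_apply,
    Pi.add_apply, LinearMap.coe_mk, AddHom.coe_mk, Matrix.diagonal_apply, sub_neg_eq_add]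
  rw [add_comm]
  congr 1
  by_cases hab : a = b
  · subst hab
    simp
  · simp [hab]

/-- If a square submatrix is invertible, a beamforming vector supported on its columns reaches
one of its rows with gain one and is zero-forced at the others. -/
theorem exists_zeroForcing {n KR KT : ℕ} {h : Fin KR → Fin KT → ℂ} (e : Fin n → Fin KR)
    (f : Fin n ↪ Fin KT) (hdet : (Matrix.of fun a b => h (e a) (f b)).det ≠ 0) (a₀ : Fin n) :
    ∃ c : Fin KT → ℂ, (∀ i, i ∉ Set.range f → c i = 0) ∧
      ∀ a, ∑ i, h (e a) i * c i = if a = a₀ then 1 else 0 := by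
  classical
  set A : Matrix (Fin n) (Fin n) ℂ := Matrix.of fun a b => h (e a) (f b) with hA
  -- Column `a₀` of the inverse, spread over the columns `f` and zero elsewhere.
  refine ⟨fun i => ∑ b, if f b = i then A⁻¹ b a₀ else 0, fun i hi => ?_, fun a => ?_⟩
  · refine Finset.sum_eq_zero fun b _ => if_neg fun hb => hi ⟨b, hb⟩
  · simp only [Finset.mul_sum]
    rw [Finset.sum_comm]
    have h1 : ∀ b, ∑ i, h (e a) i * (if f b = i then A⁻¹ b a₀ else 0) = A a b * A⁻¹ b a₀ := by
      intro b
      rw [Finset.sum_eq_single (f b)]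
      · simp [hA]
      · intro i _ hi
        rw [if_neg (Ne.symm hi), mul_zero]
      · simp
    rw [Finset.sum_congr rfl fun b _ => h1 b, ← Matrix.mul_apply,
      Matrix.mul_nonsing_inv A (isUnit_iff_ne_zero.mpr hdet), Matrix.one_apply]

/-! ### Counting injections and permutations -/

theorem card_embedding_extending {α β γ : Type*} [Fintype α] [Fintype β] [Fintype γ]
    [DecidableEq γ] (f : α ↪ γ) :
    Nat.card {g : α ⊕ β ↪ γ // ∀ a, g (Sum.inl a) = f a} =
      (Fintype.card γ - Fintype.card α).descFactorial (Fintype.card β) := by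
  classical
  have e : {g : α ⊕ β ↪ γ // ∀ a, g (Sum.inl a) = f a} ≃ (β ↪ ↥(Set.range f)ᶜ) :=
    { toFun := fun g =>
        ⟨fun b => ⟨g.1 (Sum.inr b), by
          rintro ⟨a, ha⟩
          rw [← g.2 a] at ha
          simpa using g.1.injective ha⟩, fun b b' hb => by
            simpa using g.1.injective (Subtype.ext_iff.mp hb)⟩
      invFun := fun k =>
        ⟨⟨Sum.elim f fun b => (k b : γ), by
          refine f.injective.sumElim (Subtype.val_injective.comp k.injective) fun a b hab => ?_
          exact (k b).2 ⟨a, hab⟩⟩, fun a => rfl⟩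
      left_inv := fun g => by
        ext x
        rcases x with a | b
        · exact (g.2 a).symm
        · rfl
      right_inv := fun k => by
        ext b
        rfl }
  rw [Nat.card_congr e, Nat.card_eq_fintype_card, Fintype.card_embedding_eq,
    Fintype.card_compl_set, Set.card_range_of_injective f.injective]

/-- The number of injections with prescribed values on a subset. -/
theorem card_embedding_prescribed {ι γ : Type*} [Fintype ι] [Fintype γ] [DecidableEq γ]
    (p : ι → Prop) [DecidablePred p] (f : {i // p i} ↪ γ) :
    Nat.card {g : ι ↪ γ // ∀ i : {i // p i}, g i = f i} =
      (Fintype.card γ - Fintype.card {i // p i}).descFactorial (Fintype.card {i // ¬ p i}) := by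
  rw [← card_embedding_extending (β := {i // ¬ p i}) f]
  refine Nat.card_congr (Equiv.subtypeEquiv
    ((Equiv.sumCompl p).symm.embeddingCongr (Equiv.refl γ)) fun g => ?_)
  refine forall_congr' fun i => ?_
  simp [Equiv.embeddingCongr]

theorem card_perm_apply_eq {n : ℕ} (r i : Fin n) :
    Nat.card {σ : Equiv.Perm (Fin n) // σ r = i} = (n - 1)! := by
  have h := card_embedding_prescribed (fun x : Fin n => x = r)
    (⟨fun _ => i, fun x y _ => Subtype.ext (x.2.trans y.2.symm)⟩ : {x // x = r} ↪ Fin n)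
  rw [Fintype.card_fin, Fintype.card_subtype_compl, Fintype.card_subtype_eq, Fintype.card_fin,
    Fintype.card_subtype_eq, Nat.descFactorial_self] at h
  rw [← h]
  refine (Nat.card_congr (Equiv.subtypeEquiv (Equiv.embeddingEquivOfFinite (Fin n)) fun g => ?_)).symm
  refine ⟨fun hg => hg ⟨r, rfl⟩, fun hg x => ?_⟩
  obtain ⟨x, rfl⟩ := x
  exact hg

/-! ### Seatings around a table and their rotations -/

/-- Seatings of distinct nodes around a table such that two nodes are of the same dimension
exactly when their positions agree modulo `t`. -/
structure IsTableOrder {K n : ℕ} (D t : ℕ) (π : Fin n → Fin K) : Prop where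
  inj : Function.Injective π
  dim : ∀ x y, (π x : ℕ) / D = (π y : ℕ) / D ↔ (x : ℕ) % t = (y : ℕ) % t

/-- The seating `π` read from place `k` on. -/
def rotate {α : Type*} {n : ℕ} [NeZero n] (π : Fin n → α) (k : ℕ) : Fin n → α :=
  fun x => π (Fin.ofNat n (x + k))

/-- The lattice point `ρ` consists of the `t` nodes that follow place `0`. -/
def Follows {K n D t : ℕ} [NeZero n] (ρ : LatticePoint K D t) (π : Fin n → Fin K) : Prop :=
  ∀ k, 1 ≤ k → k ≤ t → ∃ a, (ρ a : Fin K) = π (Fin.ofNat n k)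

section rotate
variable {α : Type*} {n : ℕ} [NeZero n]

theorem rotate_ofNat (π : Fin n → α) (k l : ℕ) :
    rotate π k (Fin.ofNat n l) = π (Fin.ofNat n (l + k)) := by
  unfold rotate
  congr 1
  ext
  simp

theorem rotate_rotate (π : Fin n → α) (k l : ℕ) :
    rotate (rotate π k) l = rotate π (l + k) := by
  funext x
  rw [show rotate (rotate π k) l x = rotate π k (Fin.ofNat n (x + l)) from rfl, rotate_ofNat]
  simp only [rotate, Nat.add_assoc]

theorem rotate_of_dvd (π : Fin n → α) {k : ℕ} (hk : n ∣ k) : rotate π k = π := by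
  funext x
  unfold rotate
  congr 1
  ext
  obtain ⟨c, rfl⟩ := hk
  simp [Nat.mod_eq_of_lt x.2]

theorem rotate_apply_zero (π : Fin n → α) (x : Fin n) : rotate π x 0 = π x := by
  unfold rotate
  congr 1
  ext
  simp

end rotate

theorem modEq_add_right_cancel_iff {a b c n : ℕ} : (a + c) % n = (b + c) % n ↔ a % n = b % n :=
  ⟨fun h => Nat.ModEq.add_right_cancel' c h, fun h => Nat.ModEq.add_right c h⟩

namespace IsTableOrder
variable {K n D t : ℕ} [NeZero n] {π : Fin n → Fin K}

theorem dim_ofNat (hπ : IsTableOrder D t π) (htn : t ∣ n) (k l : ℕ) :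
    (π (Fin.ofNat n k) : ℕ) / D = (π (Fin.ofNat n l) : ℕ) / D ↔ k % t = l % t := by
  rw [hπ.dim]
  simp [Nat.mod_mod_of_dvd _ htn]

theorem ofNat_inj (hπ : IsTableOrder D t π) (k l : ℕ) :
    π (Fin.ofNat n k) = π (Fin.ofNat n l) ↔ k % n = l % n := by
  rw [hπ.inj.eq_iff, Fin.ext_iff]
  simp

theorem rotate (hπ : IsTableOrder D t π) (htn : t ∣ n) (k : ℕ) :
    IsTableOrder D t (rotate π k) := by
  refine ⟨fun x y h => ?_, fun x y => ?_⟩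
  · have h' := (hπ.ofNat_inj _ _).1 h
    rw [modEq_add_right_cancel_iff, Nat.mod_eq_of_lt x.2, Nat.mod_eq_of_lt y.2] at h'
    exact Fin.ext h'
  · exact (hπ.dim_ofNat htn _ _).trans modEq_add_right_cancel_iff

/-- The `t` nodes that follow place `0` form a lattice point. -/
theorem exists_follows {π : Fin n → Fin (D * t)} (hπ : IsTableOrder D t π) (htn : t ∣ n) :
    ∃ ρ : LatticePoint (D * t) D t, Follows ρ π := by
  have hlt : ∀ j : Fin (D * t), (j : ℕ) / D < t := fun j =>
    Nat.div_lt_of_lt_mul j.2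
  have hcong : ∀ k l, 1 ≤ k → k ≤ t → 1 ≤ l → l ≤ t →
      (π (Fin.ofNat n k) : ℕ) / D = (π (Fin.ofNat n l) : ℕ) / D → k = l := by
    intro k l hk hkt hl hlt h
    rw [hπ.dim_ofNat htn] at h
    obtain ⟨k, rfl⟩ := Nat.exists_eq_add_of_le' hk
    obtain ⟨l, rfl⟩ := Nat.exists_eq_add_of_le' hl
    rw [modEq_add_right_cancel_iff, Nat.mod_eq_of_lt (by omega), Nat.mod_eq_of_lt (by omega)] at h
    rw [h]
  have hinj : Function.Injective fun r : Fin t =>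
      (⟨(π (Fin.ofNat n (r + 1)) : ℕ) / D, hlt _⟩ : Fin t) := by
    intro r s h
    have := hcong (r + 1) (s + 1) (by omega) (by omega) (by omega) (by omega) (Fin.ext_iff.1 h)
    exact Fin.ext (by omega)
  have hsurj := Finite.surjective_of_injective hinj
  choose f hf using hsurj
  refine ⟨fun a => ⟨π (Fin.ofNat n (f a + 1)), Fin.ext_iff.1 (hf a)⟩, fun k hk hkt => ?_⟩
  refine ⟨⟨(π (Fin.ofNat n k) : ℕ) / D, hlt _⟩, ?_⟩
  have h := Fin.ext_iff.1 (hf ⟨(π (Fin.ofNat n k) : ℕ) / D, hlt _⟩)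
  have h2 := hcong _ k (by omega) (by omega) hk hkt h
  simp only [h2]

/-- A lattice point has one node per dimension, and the places `1, …, t` already realise every
residue modulo `t`. A node of `ρ` at place `k` is thus the one at the place of `1, …, t` with the
same residue. -/
theorem mem_iff_of_follows {ρ : LatticePoint K D t} (hπ : IsTableOrder D t π) (htn : t ∣ n)
    (ht : 0 < t) (hlt : t < n) (hρ : Follows ρ π) {k : ℕ} (hk : k < n) :
    (∃ a, (ρ a : Fin K) = π (Fin.ofNat n k)) ↔ 1 ≤ k ∧ k ≤ t := by
  refine ⟨?_, fun h => hρ k h.1 h.2⟩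
  rintro ⟨a, ha⟩
  -- Residue `0` is represented by `t`, since place `0` is outside the range.
  obtain ⟨l, hl1, hlt', hlk⟩ : ∃ l, 1 ≤ l ∧ l ≤ t ∧ l % t = k % t := by
    rcases Nat.eq_zero_or_pos (k % t) with h0 | h0
    · exact ⟨t, ht, le_rfl, by simp [h0]⟩
    · exact ⟨k % t, h0, (Nat.mod_lt _ ht).le, Nat.mod_mod _ _⟩
  obtain ⟨b, hb⟩ := hρ l hl1 hlt'
  have hab : b = a := by
    apply Fin.ext
    rw [← (ρ a).2, ← (ρ b).2, ha, hb]
    exact (hπ.dim_ofNat htn _ _).2 hlk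
  rw [hab, ha, hπ.ofNat_inj, Nat.mod_eq_of_lt hk, Nat.mod_eq_of_lt (by omega)] at hb
  omega

/-- The places of `ρ` form the arc `1, …, t`, which omits place `0`. Place `k` must lie outside this
arc and its successor inside, and only `0` is such a place. -/
theorem eq_zero_of_follows_rotate {ρ : LatticePoint K D t} (hπ : IsTableOrder D t π)
    (htn : t ∣ n) (ht : 0 < t) (hlt : t < n) (hρ : Follows ρ π) {k : ℕ} (hk : k < n)
    (hρk : Follows ρ (_root_.rotate π k)) : k = 0 := by
  have h0 := (hπ.rotate htn k).mem_iff_of_follows htn ht hlt hρk (k := 0) (by omega)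
  rw [rotate_ofNat, zero_add, hπ.mem_iff_of_follows htn ht hlt hρ hk] at h0
  obtain ⟨a, ha⟩ := hρk 1 le_rfl ht
  rw [rotate_ofNat] at ha
  by_contra hk0
  by_cases hkn : 1 + k < n
  · have := (hπ.mem_iff_of_follows htn ht hlt hρ hkn).1 ⟨a, ha⟩
    omega
  -- The successor wraps around to place `0`, which is not in the arc.
  · have hkn' : 1 + k = n := by omega
    have h1 : Fin.ofNat n (1 + k) = Fin.ofNat n 0 := by
      ext
      simp [hkn']
    rw [h1] at ha
    have := (hπ.mem_iff_of_follows htn ht hlt hρ (k := 0) (by omega)).1 ⟨a, ha⟩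
    omega

theorem eq_of_follows_rotate {ρ : LatticePoint K D t} (hπ : IsTableOrder D t π)
    (htn : t ∣ n) (ht : 0 < t) (hlt : t < n) {x y : Fin n} (hx : Follows ρ (_root_.rotate π x))
    (hy : Follows ρ (_root_.rotate π y)) : x = y := by
  have h : _root_.rotate π y = _root_.rotate (_root_.rotate π x) ((y + (n - x)) % n) := by
    rw [rotate_rotate]
    funext z
    unfold _root_.rotate
    congr 1
    ext
    simp only [Fin.val_ofNat]
    rw [← Nat.add_assoc, Nat.add_right_comm, Nat.add_mod_mod,
      show (z : ℕ) + x + (y + (n - x)) = z + y + n by omega, Nat.add_mod_right]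
  rw [h] at hy
  have h0 := (hπ.rotate htn x).eq_zero_of_follows_rotate htn ht hlt hx (Nat.mod_lt _ x.pos) hy
  -- The shift `y + (n - x)` is a multiple of `n` strictly between `0` and `2 * n`.
  obtain ⟨c, hc⟩ := Nat.dvd_of_mod_eq_zero h0
  have : c = 1 := by
    have h1 : c < 2 := by
      by_contra hc2
      have : n * 2 ≤ n * c := Nat.mul_le_mul_left _ (by omega)
      omega
    have h2 : c ≠ 0 := by
      rintro rfl
      omega
    omega
  subst this
  exact Fin.ext (by omega)

end IsTableOrder

theorem card_fin_mod_eq {δ t r : ℕ} (hr : r < t) :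
    (Finset.univ.filter fun x : Fin (δ * t + t) => (x : ℕ) % t = r).card = δ + 1 := by
  have hlt : ∀ c : Fin (δ + 1), r + t * c < δ * t + t := by
    intro c
    have : t * c ≤ t * δ := Nat.mul_le_mul_left _ (by omega)
    rw [Nat.mul_comm δ t]
    omega
  have h : (Finset.univ.filter fun x : Fin (δ * t + t) => (x : ℕ) % t = r) =
      Finset.univ.image fun c : Fin (δ + 1) => (⟨r + t * c, hlt c⟩ : Fin (δ * t + t)) := by
    ext x
    simp only [Finset.mem_filter, Finset.mem_univ, true_and, Finset.mem_image]
    constructor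
    · rintro hx
      refine ⟨⟨x / t, ?_⟩, ?_⟩
      · rw [Nat.div_lt_iff_lt_mul (by omega), Nat.add_mul, one_mul]
        exact x.2
      · ext
        simp only [← hx]
        exact Nat.mod_add_div _ _
    · rintro ⟨c, rfl⟩
      simp [Nat.mod_eq_of_lt hr]
  rw [h, Finset.card_image_of_injective _ fun c c' hcc => ?_, Finset.card_fin]
  have := Fin.ext_iff.1 hcc
  simp only at this
  exact Fin.ext (Nat.eq_of_mul_eq_mul_left (by omega : 0 < t) (by omega))

/-- Each residue class modulo `t` has `δ + 1` places and the `t` classes exhaust the `t` dimensions.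
Distinct places in one class differ by a multiple of `t` below `(δ + 1) * t`. -/
theorem IsTableOrder.isHypercubePermutation {D t δ : ℕ}
    {π : Fin (δ * t + t) → Fin (D * t)} (hπ : IsTableOrder D t π) :
    IsHypercubePermutation D t (δ + 1) π := by
  refine ⟨hπ.inj, fun i hi => ?_, ?_⟩
  · have hlt : ∀ j : Fin (D * t), (j : ℕ) / D < t := fun j => Nat.div_lt_of_lt_mul j.2
    have hinj : Function.Injective fun r : Fin t =>
        (⟨(π ⟨r, by omega⟩ : ℕ) / D, hlt _⟩ : Fin t) := by
      intro r s h
      have h' := (hπ.dim _ _).1 (Fin.ext_iff.1 h)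
      simp only [Nat.mod_eq_of_lt r.2, Nat.mod_eq_of_lt s.2] at h'
      exact Fin.ext h'
    obtain ⟨r, hr⟩ := Finite.surjective_of_injective hinj ⟨i, hi⟩
    have hr' := Fin.ext_iff.1 hr
    simp only at hr'
    rw [← card_fin_mod_eq (δ := δ) r.2]
    congr 1
    ext x
    simp only [Finset.mem_filter, Finset.mem_univ, true_and]
    rw [← hr', hπ.dim]
    simp [Nat.mod_eq_of_lt r.2]
  · have key : ∀ x y : Fin (δ * t + t), x < y → (π x : ℕ) / D = (π y : ℕ) / D →
        ∃ k : ℕ, 1 ≤ k ∧ k ≤ δ ∧ ((y : ℤ) - (x : ℤ)).natAbs = k * t := by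
      intro x y hxy h
      rw [hπ.dim] at h
      have hdvd : t ∣ (y : ℕ) - x := (Nat.modEq_iff_dvd' hxy.le).1 h
      obtain ⟨k, hk⟩ := hdvd
      have hxy' : (x : ℕ) < y := hxy
      replace hk : (y : ℕ) - x = k * t := hk.trans (Nat.mul_comm t k)
      refine ⟨k, ?_, ?_, by omega⟩
      · rcases Nat.eq_zero_or_pos k with rfl | h0
        · omega
        · exact h0
      · have : k * t < (δ + 1) * t := by
          rw [Nat.add_mul, one_mul]
          omega
        exact Nat.lt_succ_iff.1 (Nat.lt_of_mul_lt_mul_right this)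
    intro x y hxy h
    rcases lt_or_gt_of_ne hxy with hlt | hlt
    · obtain ⟨k, h1, h2, h3⟩ := key x y hlt h
      exact ⟨k, h1, by omega, by omega⟩
    · obtain ⟨k, h1, h2, h3⟩ := key y x hlt h.symm
      exact ⟨k, h1, by omega, by omega⟩

/-! ### Counting the seatings with given first nodes -/

theorem card_fin_div_eq {D t i : ℕ} (hi : i < t) :
    Fintype.card {k : Fin (D * t) // (k : ℕ) / D = i} = D := by
  rcases Nat.eq_zero_or_pos D with rfl | hD
  · rw [Fintype.card_eq_zero_iff]
    exact ⟨fun k => absurd k.1.2 (by simp)⟩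
  have hlt : ∀ c : Fin D, D * i + c < D * t := fun c => by
    have : D * (i + 1) ≤ D * t := Nat.mul_le_mul_left _ hi
    rw [Nat.mul_add] at this
    omega
  have e : Fin D ≃ {k : Fin (D * t) // (k : ℕ) / D = i} :=
    { toFun := fun c => ⟨⟨D * i + c, hlt c⟩, by
        simp [Nat.mul_add_div hD, Nat.div_eq_of_lt c.2]⟩
      invFun := fun k => ⟨(k.1 : ℕ) % D, Nat.mod_lt _ hD⟩
      left_inv := fun c => by
        ext
        simp [Nat.mod_eq_of_lt c.2]
      right_inv := fun k => by
        ext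
        simp only [← k.2]
        exact Nat.div_add_mod _ _ }
  rw [← Fintype.card_congr e, Fintype.card_fin]

/-- Among the places `0, …, t`, residue `0` occurs twice, at `0` and at `t`; every other residue
occurs once. -/
theorem card_initial_places {δ t : ℕ} (hδ : 0 < δ) (r : Fin t) :
    Fintype.card {c : Fin (δ + 1) // (r : ℕ) + t * c ≤ t} = if (r : ℕ) = 0 then 2 else 1 := by
  have ht : 0 < t := r.pos
  obtain ⟨δ, rfl⟩ := Nat.exists_eq_add_of_le' hδ
  have hc : ∀ c : Fin (δ + 1 + 1), (r : ℕ) + t * c ≤ t ↔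
      c = 0 ∨ ((r : ℕ) = 0 ∧ c = 1) := by
    intro c
    rcases Nat.lt_or_ge (c : ℕ) 2 with h | h
    · have h01 : c = 0 ∨ c = 1 := by
        rcases Nat.lt_or_ge (c : ℕ) 1 with h' | h'
        · left; ext; simpa using h'
        · right; ext; simp; omega
      rcases h01 with rfl | rfl
      · simp [r.2.le]
      · simp
    · have h2 : t * 2 ≤ t * c := Nat.mul_le_mul_left _ h
      refine ⟨fun h => by omega, ?_⟩
      rintro (rfl | ⟨-, rfl⟩) <;> simp at h
  rw [Fintype.card_subtype]
  simp only [hc]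
  split_ifs with h0
  · have : (Finset.univ.filter fun c : Fin (δ + 1 + 1) => c = 0 ∨ ((r : ℕ) = 0 ∧ c = 1)) =
        {0, 1} := by
      ext c
      simp [h0]
    rw [this, Finset.card_pair (by simp)]
  · have : (Finset.univ.filter fun c : Fin (δ + 1 + 1) => c = 0 ∨ ((r : ℕ) = 0 ∧ c = 1)) =
        {0} := by
      ext c
      simp [h0]
    rw [this, Finset.card_singleton]

/-- The seatings with prescribed dimensions and prescribed nodes at the places `0, …, t`
are families of injections, one for each residue modulo `t`. -/
def seatingsEquiv {D t δ : ℕ} (ht : 0 < t) (σ : Equiv.Perm (Fin t))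
    (v : ∀ r : Fin t, {c : Fin (δ + 1) // (r : ℕ) + t * c ≤ t} →
      {k : Fin (D * t) // (k : ℕ) / D = (σ r : ℕ)}) :
    {π : Fin (δ * t + t) → Fin (D * t) // Function.Injective π ∧
      (∀ x, (π x : ℕ) / D = (σ ⟨(x : ℕ) % t, Nat.mod_lt _ ht⟩ : ℕ)) ∧
      ∀ (r : Fin t) (c : {c : Fin (δ + 1) // (r : ℕ) + t * c ≤ t})
        (hlt : (r : ℕ) + t * c < δ * t + t), π ⟨r + t * c, hlt⟩ = v r c} ≃
    ∀ r : Fin t, {g : Fin (δ + 1) ↪ {k : Fin (D * t) // (k : ℕ) / D = (σ r : ℕ)} //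
      ∀ c : {c : Fin (δ + 1) // (r : ℕ) + t * c ≤ t}, g c = v r c} where
  toFun π r :=
    have hlt : ∀ c : Fin (δ + 1), r + t * c < δ * t + t := by
      intro c
      have : t * c ≤ t * δ := Nat.mul_le_mul_left _ (by omega)
      rw [Nat.mul_comm δ t]
      omega
    ⟨⟨fun c => ⟨π.1 ⟨r + t * c, hlt c⟩, by
      rw [π.2.2.1]
      congr 2
      ext
      simp [Nat.mod_eq_of_lt r.2]⟩, fun c c' h => by
        have h' := Fin.ext_iff.1 (π.2.1 (Subtype.ext_iff.1 h))
        simp only at h'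
        exact Fin.ext (Nat.eq_of_mul_eq_mul_left ht (by omega))⟩,
      fun c => Subtype.ext (π.2.2.2 r c (hlt c))⟩
  invFun g :=
    have hlt : ∀ x : Fin (δ * t + t), (x : ℕ) / t < δ + 1 := by
      intro x
      rw [Nat.div_lt_iff_lt_mul ht, Nat.add_mul, one_mul]
      exact x.2
    ⟨fun x => (g ⟨(x : ℕ) % t, Nat.mod_lt _ ht⟩).1 ⟨(x : ℕ) / t, hlt x⟩, by
      intro x y hxy
      simp only at hxy
      have h1 := ((g ⟨(x : ℕ) % t, Nat.mod_lt _ ht⟩).1 ⟨(x : ℕ) / t, hlt x⟩).2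
      have h2 := ((g ⟨(y : ℕ) % t, Nat.mod_lt _ ht⟩).1 ⟨(y : ℕ) / t, hlt y⟩).2
      rw [hxy, h2] at h1
      have h3 := σ.injective (Fin.ext h1)
      rw [Fin.mk.injEq] at h3
      have h4 : ∀ (r s : Fin t) (c c' : Fin (δ + 1)), r = s →
          ((g r).1 c : Fin (D * t)) = (g s).1 c' → c = c' := by
        rintro r s c c' rfl h
        exact (g r).1.injective (Subtype.ext h)
      have h5 := Fin.ext_iff.1 (h4 _ _ _ _ (Fin.ext h3.symm) hxy)
      simp only at h5
      exact Fin.ext (by rw [← Nat.mod_add_div x t, ← Nat.mod_add_div y t, h3, h5]),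
    fun x => ((g ⟨(x : ℕ) % t, Nat.mod_lt _ ht⟩).1 ⟨(x : ℕ) / t, hlt x⟩).2,
    fun r c hc => by
      have h4 : ∀ (s : Fin t) (c' : Fin (δ + 1)), s = r → c' = c.1 →
          ((g s).1 c' : Fin (D * t)) = v r c := by
        rintro s c' rfl rfl
        rw [(g s).2 c]
      refine h4 _ _ (Fin.ext ?_) (Fin.ext ?_)
      · simp [Nat.mod_eq_of_lt r.2]
      · simp [Nat.add_mul_div_left _ _ ht, Nat.div_eq_of_lt r.2]⟩
  left_inv π := by
    ext x
    change (π.1 ⟨(x : ℕ) % t + t * ((x : ℕ) / t), _⟩ : ℕ) = π.1 x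
    exact congrArg (fun z => (π.1 z : ℕ)) (Fin.ext (Nat.mod_add_div _ _))
  right_inv g := by
    funext r
    ext c
    have h4 : ∀ (s : Fin t) (c' : Fin (δ + 1)), s = r → c' = c →
        (((g s).1 c' : Fin (D * t)) : ℕ) = ((g r).1 c : Fin (D * t)) := by
      rintro s c' rfl rfl
      rfl
    refine h4 _ _ (Fin.ext ?_) (Fin.ext ?_)
    · simp [Nat.mod_eq_of_lt r.2]
    · simp [Nat.add_mul_div_left _ _ ht, Nat.div_eq_of_lt r.2]

/-- The count is a product over residues: each dimension has `D` nodes and must fill `δ + 1` places,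
of which two are prescribed for residue `0` and one for any other residue. -/
theorem card_seatings {D t δ : ℕ} (ht : 0 < t) (hδ : 0 < δ) (σ : Equiv.Perm (Fin t))
    (v : ∀ r : Fin t, {c : Fin (δ + 1) // (r : ℕ) + t * c ≤ t} →
      {k : Fin (D * t) // (k : ℕ) / D = (σ r : ℕ)}) (hv : ∀ r, Function.Injective (v r)) :
    Nat.card {π : Fin (δ * t + t) → Fin (D * t) // Function.Injective π ∧
      (∀ x, (π x : ℕ) / D = (σ ⟨(x : ℕ) % t, Nat.mod_lt _ ht⟩ : ℕ)) ∧
      ∀ (r : Fin t) (c : {c : Fin (δ + 1) // (r : ℕ) + t * c ≤ t})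
        (hlt : (r : ℕ) + t * c < δ * t + t), π ⟨r + t * c, hlt⟩ = v r c} =
      (D - 2).descFactorial (δ - 1) * (D - 1).descFactorial δ ^ (t - 1) := by
  rw [Nat.card_congr (seatingsEquiv ht σ v), Nat.card_pi]
  have h : ∀ r : Fin t,
      Nat.card {g : Fin (δ + 1) ↪ {k : Fin (D * t) // (k : ℕ) / D = (σ r : ℕ)} //
        ∀ c : {c : Fin (δ + 1) // (r : ℕ) + t * c ≤ t}, g c = v r c} =
      if (r : ℕ) = 0 then (D - 2).descFactorial (δ - 1) else (D - 1).descFactorial δ := by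
    intro r
    refine (card_embedding_prescribed (fun c : Fin (δ + 1) => (r : ℕ) + t * c ≤ t)
      ⟨v r, hv r⟩).trans ?_
    rw [Fintype.card_subtype_compl, card_fin_div_eq (σ r).2, card_initial_places hδ, Fintype.card_fin]
    split_ifs
    · congr 1
    · congr 1
  rw [Finset.prod_congr rfl fun r _ => h r]
  obtain ⟨t, rfl⟩ := Nat.exists_eq_add_of_le' ht
  simp [Fin.prod_univ_succ]

/-- The number of seatings with a given node at place `0`, followed by the nodes of a given
lattice point. -/
theorem card_tableOrder_follows {D t δ : ℕ} [NeZero (δ * t + t)] (ht : 0 < t) (hδ : 0 < δ)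
    (j : Fin (D * t)) (ρ : LatticePoint (D * t) D t) (hj : ∀ a, (ρ a : Fin (D * t)) ≠ j) :
    Nat.card {π : Fin (δ * t + t) → Fin (D * t) //
      IsTableOrder D t π ∧ π 0 = j ∧ Follows ρ π} =
      (t - 1)! * ((D - 2).descFactorial (δ - 1) * (D - 1).descFactorial δ ^ (t - 1)) := by
  have hlt : ∀ k : Fin (D * t), (k : ℕ) / D < t := fun k => Nat.div_lt_of_lt_mul k.2
  have hn : ∀ r : Fin t, (r : ℕ) < δ * t + t := fun r => by omega
  have htn : t ∣ δ * t + t := ⟨δ + 1, by ring⟩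
  have htlt : t < δ * t + t := by
    have : 0 < δ * t := Nat.mul_pos hδ ht
    omega
  set X := {π : Fin (δ * t + t) → Fin (D * t) // IsTableOrder D t π ∧ π 0 = j ∧ Follows ρ π}
  have hbij : ∀ π : X, Function.Bijective fun r : Fin t =>
      (⟨(π.1 ⟨r, hn r⟩ : ℕ) / D, hlt _⟩ : Fin t) := by
    intro π
    rw [← Finite.injective_iff_bijective]
    intro r s h
    have h' := (π.2.1.dim _ _).1 (Fin.ext_iff.1 h)
    simp only [Nat.mod_eq_of_lt r.2, Nat.mod_eq_of_lt s.2] at h'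
    exact Fin.ext h'
  -- `Φ` records which dimension occupies each residue. Residue `0` must carry the dimension of `j`,
  -- which leaves `(t - 1)!` values, all with fibres of the same size.
  let Φ : X → {σ : Equiv.Perm (Fin t) // σ ⟨0, ht⟩ = ⟨(j : ℕ) / D, hlt j⟩} := fun π =>
    ⟨Equiv.ofBijective _ (hbij π), by
      ext
      exact congrArg (fun z : Fin (D * t) => (z : ℕ) / D) π.2.2.1⟩
  rw [← Nat.card_congr (Equiv.sigmaFiberEquiv Φ), Nat.card_sigma]
  have hfib : ∀ σ, Nat.card {x : X // Φ x = σ} =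
      (D - 2).descFactorial (δ - 1) * (D - 1).descFactorial δ ^ (t - 1) := by
    rintro ⟨σ, hσ⟩
    -- The nodes forced at the places `0, …, t`: `j` at place `0`, and elsewhere the node of `ρ` in
    -- the dimension of that residue.
    let v : ∀ r : Fin t, {c : Fin (δ + 1) // (r : ℕ) + t * c ≤ t} →
        {k : Fin (D * t) // (k : ℕ) / D = (σ r : ℕ)} := fun r c =>
      if h : (r : ℕ) + t * c = 0 then ⟨j, by
        have hr : r = ⟨0, ht⟩ := Fin.ext (by simp; omega)
        rw [hr, hσ]⟩
      else ρ (σ r)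
    have hv : ∀ r, Function.Injective (v r) := by
      intro r c c' hcc
      have hne : ∀ (h1 h2), (⟨j, h1⟩ : {k : Fin (D * t) // (k : ℕ) / D = (σ r : ℕ)}) ≠
          ⟨ρ (σ r), h2⟩ := fun h1 h2 h => hj (σ r) (Subtype.ext_iff.1 h).symm
      have hsmall : ∀ c : {c : Fin (δ + 1) // (r : ℕ) + t * c ≤ t},
          (c : ℕ) = 0 ∨ ((c : ℕ) = 1 ∧ (r : ℕ) = 0) := by
        intro c
        have hc := c.2
        rcases Nat.lt_or_ge (c : ℕ) 2 with h | h
        · rcases Nat.lt_or_ge (c : ℕ) 1 with h' | h'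
          · left; omega
          · have h1 : (c : ℕ) = 1 := by omega
            rw [h1] at hc
            right; omega
        · have : t * 2 ≤ t * c := Nat.mul_le_mul_left _ h
          omega
      apply Subtype.ext
      apply Fin.ext
      rcases hsmall c with h | ⟨h, hr⟩ <;> rcases hsmall c' with h' | ⟨h', hr'⟩
      · rw [h, h']
      · exfalso
        simp only [v, h, h', hr'] at hcc
        rw [dif_pos (by simp), dif_neg (by omega)] at hcc
        exact hne _ _ hcc
      · exfalso
        simp only [v, h, h', hr] at hcc
        rw [dif_neg (by omega), dif_pos (by simp)] at hcc
        exact hne _ _ hcc.symm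
      · rw [h, h']
    have hσx : ∀ (x : {x : X // Φ x = ⟨σ, hσ⟩}) (r : Fin t),
        (x.1.1 ⟨r, hn r⟩ : ℕ) / D = (σ r : ℕ) := fun x r =>
      congrArg (fun s : {σ : Equiv.Perm (Fin t) // σ ⟨0, ht⟩ = ⟨(j : ℕ) / D, hlt j⟩} =>
        (s.1 r : ℕ)) x.2
    rw [← card_seatings ht hδ σ v hv]
    refine Nat.card_congr
      { toFun := fun x => ⟨x.1.1, x.1.2.1.inj, ?_, ?_⟩
        invFun := fun π => ⟨⟨π.1, ⟨π.2.1, ?_⟩, ?_, ?_⟩, ?_⟩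
        left_inv := fun x => rfl
        right_inv := fun π => rfl }
    · intro x'
      rw [← hσx x, x.1.2.1.dim]
      simp
    · intro r c hc
      simp only [v]
      split_ifs with h0
      · simp only [h0]
        exact x.1.2.2.1
      · obtain ⟨a, ha⟩ := x.1.2.2.2 (r + t * c) (by omega) c.2
        have hmk : (⟨r + t * c, hc⟩ : Fin (δ * t + t)) = Fin.ofNat (δ * t + t) (r + t * c) := by
          ext
          simp [Nat.mod_eq_of_lt hc]
        rw [hmk, ← ha]
        have : a = σ r := by
          ext
          rw [← (ρ a).2, ha, ← hσx x, ← hmk, x.1.2.1.dim]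
          simp
        rw [this]
    · intro x y
      rw [π.2.2.1, π.2.2.1, ← Fin.ext_iff, σ.injective.eq_iff, Fin.mk.injEq]
    · have h := π.2.2.2 ⟨0, ht⟩ ⟨0, by simp⟩ (by simp; omega)
      simp only [v] at h
      rw [dif_pos (by simp)] at h
      exact (congrArg π.1 (Fin.ext (by simp))).trans h
    · intro k hk hkt
      have h1 : ∀ (r : Fin t) (c : Fin (δ + 1)), (r : ℕ) + t * c = k →
          π.1 (Fin.ofNat (δ * t + t) k) = ρ (σ r) := by
        intro r c hrc
        have h := π.2.2.2 r ⟨c, by omega⟩ (show (r : ℕ) + t * c < δ * t + t by omega)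
        simp only [v] at h
        rw [dif_neg (by omega)] at h
        refine (congrArg π.1 (Fin.ext ?_)).trans h
        simp only [Fin.val_ofNat, hrc]
        exact Nat.mod_eq_of_lt (by omega)
      -- Place `k < t` opens residue `k`, while place `t` is the second place of residue `0`.
      rcases hkt.lt_or_eq with hlt' | rfl
      · exact ⟨_, (h1 ⟨k, hlt'⟩ 0 (by simp)).symm⟩
      · exact ⟨_, (h1 ⟨0, ht⟩ ⟨1, by omega⟩ (by simp)).symm⟩
    · apply Subtype.ext
      ext r
      simp only [Φ, Equiv.ofBijective_apply]
      rw [π.2.2.1]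
      simp [Nat.mod_eq_of_lt r.2]
  rw [Finset.sum_congr rfl fun σ _ => hfib σ, Finset.sum_const, Finset.card_univ,
    ← Nat.card_eq_fintype_card, card_perm_apply_eq, smul_eq_mul]

/-! ### Subfile sizes, existence of placements and memory -/

/-- The number of packets of a subfile. -/
def subfileSize (D t δ : ℕ) : ℕ :=
  (t - 1)! * ((D - 2).descFactorial (δ - 1) * (D - 1).descFactorial δ ^ (t - 1))

/-- The division by `δ` comes from the one factor `(δ - 1)! = δ! / δ`, produced by the residue with
two prescribed nodes. -/
theorem cast_subfileSize (D : ℕ) {t δ : ℕ} (ht : 0 < t) (hδ : 0 < δ) :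
    (subfileSize D t δ : ℝ) = ((D - 2).choose (δ - 1) : ℝ) * ((D - 1).choose δ : ℝ) ^ (t - 1)
        * (((δ ! : ℕ) : ℝ) ^ t / (δ : ℝ)) * (((t - 1)! : ℕ) : ℝ) := by
  obtain ⟨t, rfl⟩ := Nat.exists_eq_add_of_le' ht
  obtain ⟨δ, rfl⟩ := Nat.exists_eq_add_of_le' hδ
  have h : (((δ + 1)! : ℕ) : ℝ) = ((δ + 1 : ℕ) : ℝ) * (δ ! : ℕ) := by
    rw [Nat.factorial_succ, Nat.cast_mul]
  have h0 : ((δ + 1 : ℕ) : ℝ) ≠ 0 := Nat.cast_ne_zero.2 (by omega)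
  simp only [subfileSize, Nat.descFactorial_eq_factorial_mul_choose, Nat.add_sub_cancel,
    Nat.cast_mul, Nat.cast_pow, pow_succ, mul_pow]
  rw [mul_div_assoc, h, mul_div_cancel_left₀ _ h0]
  ring

theorem card_latticePoint (D t : ℕ) : Fintype.card (LatticePoint (D * t) D t) = D ^ t := by
  rw [Fintype.card_pi, Finset.prod_congr rfl fun i _ => card_fin_div_eq i.2]
  simp

theorem card_latticePoint_mem {D t : ℕ} (i : Fin (D * t)) :
    (Finset.univ.filter fun τ : LatticePoint (D * t) D t =>
      ∃ a, (τ a : Fin (D * t)) = i).card * D = D ^ t := by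
  classical
  have hlt : (i : ℕ) / D < t := Nat.div_lt_of_lt_mul i.2
  have h : (Finset.univ.filter fun τ : LatticePoint (D * t) D t =>
      ∃ a, (τ a : Fin (D * t)) = i) =
      (Fintype.piFinset fun _ => Finset.univ).filter fun τ : LatticePoint (D * t) D t =>
        τ ⟨(i : ℕ) / D, hlt⟩ = ⟨i, rfl⟩ := by
    ext τ
    simp only [Finset.mem_filter, Finset.mem_univ, true_and, Fintype.mem_piFinset,
      implies_true]
    constructor
    · rintro ⟨a, ha⟩
      have : a = ⟨(i : ℕ) / D, hlt⟩ := by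
        ext
        rw [← (τ a).2, ha]
      subst this
      exact Subtype.ext ha
    · intro hτ
      exact ⟨_, congrArg Subtype.val hτ⟩
  rw [h, Fintype.card_filter_piFinset_eq_of_mem
      (fun a : Fin t => (Finset.univ : Finset {k : Fin (D * t) // (k : ℕ) / D = (a : ℕ)}))
      ⟨(i : ℕ) / D, hlt⟩ (Finset.mem_univ _),
    Finset.prod_congr rfl fun j _ => (Finset.card_univ.trans (card_fin_div_eq j.2) : _ = D), Finset.prod_const,
    Finset.card_erase_of_mem (Finset.mem_univ _), Finset.card_fin, ← pow_succ,
    Nat.sub_add_cancel (Nat.zero_lt_of_lt hlt)]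

theorem card_packet_filter {S : Type*} [Fintype S] [DecidableEq S] {N F s : ℕ}
    (sub : Fin N → Fin F → S)
    (hsub : ∀ n b, (Finset.univ.filter fun p => sub n p = b).card = s) (Q : S → Prop)
    [DecidablePred Q] :
    (Finset.univ.filter fun w : Packet N F => Q (sub w.1 w.2)).card =
      N * ((Finset.univ.filter Q).card * s) := by
  rw [Finset.card_filter, Fintype.sum_prod_type]
  simp only [← Finset.card_filter]
  have h : ∀ n, (Finset.univ.filter fun p => Q (sub n p)).card =
      (Finset.univ.filter Q).card * s := by
    intro n
    rw [Finset.card_eq_sum_card_fiberwise (f := sub n) (t := Finset.univ.filter Q)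
      (fun p hp => by simpa using hp), ← smul_eq_mul, ← Finset.sum_const]
    refine Finset.sum_congr rfl fun b hb => ?_
    rw [← hsub n b]
    congr 1
    ext p
    simp only [Finset.mem_filter, Finset.mem_univ, true_and] at hb ⊢
    exact ⟨fun h => h.2, fun h => ⟨h ▸ hb, h⟩⟩
  simp [h]

theorem exists_isHypercube (N DT tT DR tR s : ℕ) :
    ∃ C : CachePlacement (DT * tT) (DR * tR) N (DT ^ tT * DR ^ tR * s),
      C.IsHypercube DT tT DR tR := by
  classical
  have e : Fin (DT ^ tT * DR ^ tR * s) ≃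
      (LatticePoint (DT * tT) DT tT × LatticePoint (DR * tR) DR tR) × Fin s :=
    Fintype.equivOfCardEq (by
      rw [Fintype.card_prod, Fintype.card_prod, card_latticePoint, card_latticePoint,
        Fintype.card_fin, Fintype.card_fin])
  refine ⟨⟨fun i => Finset.univ.filter fun w => ∃ a, ((e w.2).1.1 a : Fin (DT * tT)) = i,
    fun j => Finset.univ.filter fun w => ∃ a, ((e w.2).1.2 a : Fin (DR * tR)) = j⟩,
    fun _ p => (e p).1, fun n b => ?_, fun i w => by simp, fun j w => by simp⟩
  have h : (Finset.univ.filter fun p => (e p).1 = b) =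
      Finset.univ.image fun c => e.symm (b, c) := by
    ext p
    simp only [Finset.mem_filter, Finset.mem_univ, true_and, Finset.mem_image]
    constructor
    · rintro rfl
      exact ⟨(e p).2, by simp⟩
    · rintro ⟨c, rfl⟩
      simp
  rw [h, Finset.card_image_of_injective _ fun c c' hc => by simpa using hc, Finset.card_fin,
    Nat.mul_comm]

theorem card_subfile {S N F : ℕ} {X : Type*} [DecidableEq X] (hS : 0 < S) {s : ℕ}
    (hF : F = S * s) {sub : Fin N → Fin F → X}
    (hsub : ∀ n b, (Finset.univ.filter fun p => sub n p = b).card * S = F) (n : Fin N) (b : X) :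
    (Finset.univ.filter fun p => sub n p = b).card = s :=
  Nat.eq_of_mul_eq_mul_left hS ((Nat.mul_comm _ _).trans ((hsub n b).trans hF))

theorem memoryFeasible_of_isHypercube {N F DT tT DR tR s : ℕ} {MT MR : ℝ} (hDT : 0 < DT)
    (hDR : 0 < DR) (hMT : (N : ℝ) / MT = DT) (hMR : (N : ℝ) / MR = DR)
    (hF : F = DT ^ tT * DR ^ tR * s) {C : CachePlacement (DT * tT) (DR * tR) N F}
    (hC : C.IsHypercube DT tT DR tR) : C.MemoryFeasible MT MR := by
  classical
  obtain ⟨sub, hsub, htx, hrx⟩ := hC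
  have hs : ∀ n b, (Finset.univ.filter fun p => sub n p = b).card = s :=
    card_subfile (Nat.mul_pos (pow_pos hDT tT) (pow_pos hDR tR)) hF fun n b => by
      convert hsub n b
  -- A node stores a fraction `1 / D` of the library, so the memory bound is attained with equality.
  have main : ∀ (A D c : ℕ) (M : ℝ), 0 < D → (N : ℝ) / M = D → A = N * (c * s) →
      c * D = DT ^ tT * DR ^ tR → (A : ℝ) ≤ M * (F : ℝ) := by
    intro A D c M hD hM hA hc
    have hD' : (D : ℝ) ≠ 0 := Nat.cast_ne_zero.2 hD.ne'
    have hM0 : M ≠ 0 := by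
      rintro rfl
      rw [div_zero] at hM
      exact hD' hM.symm
    rw [div_eq_iff hM0] at hM
    rw [hF, ← hc, hA]
    push_cast
    rw [hM]
    apply le_of_eq
    ring
  constructor
  · intro i
    refine main _ DT (Finset.univ.filter fun b :
      LatticePoint (DT * tT) DT tT × LatticePoint (DR * tR) DR tR =>
        ∃ a, (b.1 a : Fin (DT * tT)) = i).card MT hDT hMT ?_ ?_
    · rw [← card_packet_filter sub hs]
      congr 1
      ext w
      simp [htx]
    · rw [← Finset.univ_product_univ, Finset.filter_product_left
        (fun τ : LatticePoint (DT * tT) DT tT => ∃ a, (τ a : Fin (DT * tT)) = i),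
        Finset.card_product, Nat.mul_right_comm, card_latticePoint_mem, Finset.card_univ,
        card_latticePoint]
  · intro j
    refine main _ DR (Finset.univ.filter fun b :
      LatticePoint (DT * tT) DT tT × LatticePoint (DR * tR) DR tR =>
        ∃ a, (b.2 a : Fin (DR * tR)) = j).card MR hDR hMR ?_ ?_
    · rw [← card_packet_filter sub hs]
      congr 1
      ext w
      simp [hrx]
    · rw [← Finset.univ_product_univ, Finset.filter_product_right
        (fun τ : LatticePoint (DR * tR) DR tR => ∃ a, (τ a : Fin (DR * tR)) = j),
        Finset.card_product, Nat.mul_assoc, card_latticePoint_mem, Finset.card_univ,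
        card_latticePoint]

/-! ### Labelling the missing packets by seatings -/

theorem IsTableOrder.eq_of_follows {n D t : ℕ} [NeZero n] {π : Fin n → Fin (D * t)}
    (hπ : IsTableOrder D t π) (hlt : t < n) {ρ ρ' : LatticePoint (D * t) D t}
    (hρ : Follows ρ π) (hρ' : Follows ρ' π) : ρ = ρ' := by
  choose f hf using fun r : Fin t => hρ (r + 1) (by omega) (by omega)
  have hinj : Function.Injective f := by
    intro r s hrs
    have h := hf r
    rw [hrs, hf s, hπ.ofNat_inj, Nat.mod_eq_of_lt (by omega), Nat.mod_eq_of_lt (by omega)] at h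
    exact Fin.ext (by omega)
  funext a
  obtain ⟨r, rfl⟩ := Finite.surjective_of_injective hinj a
  obtain ⟨b, hb⟩ := hρ' (r + 1) (by omega) (by omega)
  have hab : b = f r := by
    ext
    rw [← (ρ (f r)).2, ← (ρ' b).2, hf, hb]
  subst hab
  exact Subtype.ext ((hf r).trans hb.symm)

theorem IsTableOrder.ne_of_follows {n D t : ℕ} [NeZero n] {π : Fin n → Fin (D * t)}
    (hπ : IsTableOrder D t π) (htn : t ∣ n) (ht : 0 < t) (hlt : t < n)
    {ρ : LatticePoint (D * t) D t} (hρ : Follows ρ π) (a : Fin t) :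
    (ρ a : Fin (D * t)) ≠ π 0 := by
  intro h
  have h0 := (hπ.mem_iff_of_follows htn ht hlt hρ (k := 0) (by omega)).1 ⟨a, h⟩
  omega

/-- The packets demanded by the receivers, in all subfiles with a given first index `τ`, are
labelled bijectively by the table orders: the receiver sits at place `0`, and the nodes that
follow it are the second index of the subfile. -/
theorem exists_labelling {X : Type*} {N F D t δ : ℕ} [NeZero (δ * t + t)] (ht : 0 < t)
    (hδ : 0 < δ) [DecidableEq (X × LatticePoint (D * t) D t)]
    (sub : Fin N → Fin F → X × LatticePoint (D * t) D t)
    (hsub : ∀ m b, (Finset.univ.filter fun p => sub m p = b).card = subfileSize D t δ)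
    (d : Fin (D * t) → Fin N) (τ : X) :
    ∃ pk : {π : Fin (δ * t + t) → Fin (D * t) // IsTableOrder D t π} → Fin F,
      (∀ π, ∃ ρ, Follows ρ π.1 ∧ sub (d (π.1 0)) (pk π) = (τ, ρ)) ∧
      (∀ π π', π.1 0 = π'.1 0 → pk π = pk π' → π = π') ∧
      ∀ j p, (∀ a, ((sub (d j) p).2 a : Fin (D * t)) ≠ j) → (sub (d j) p).1 = τ →
        ∃ π, π.1 0 = j ∧ pk π = p := by
  have htn : t ∣ δ * t + t := ⟨δ + 1, by ring⟩
  have htlt : t < δ * t + t := by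
    have : 0 < δ * t := Nat.mul_pos hδ ht
    omega
  -- Only the cardinalities agree: the bijection is an arbitrary choice for each `j` and `ρ`.
  have hex : ∀ (j : Fin (D * t)) (ρ : LatticePoint (D * t) D t),
      (∀ a, (ρ a : Fin (D * t)) ≠ j) →
      Nonempty ({π : Fin (δ * t + t) → Fin (D * t) //
        IsTableOrder D t π ∧ π 0 = j ∧ Follows ρ π} ≃ {p // sub (d j) p = (τ, ρ)}) := by
    intro j ρ hj
    refine Finite.card_eq.1 ?_
    rw [card_tableOrder_follows ht hδ j ρ hj, Nat.card_eq_fintype_card, Fintype.card_subtype,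
      hsub]
    rfl
  let e := fun j ρ hj => (hex j ρ hj).some
  choose ρ hρ using fun π : {π : Fin (δ * t + t) → Fin (D * t) // IsTableOrder D t π} =>
    π.2.exists_follows htn
  let pk : {π : Fin (δ * t + t) → Fin (D * t) // IsTableOrder D t π} → Fin F := fun π =>
    (e (π.1 0) (ρ π) (π.2.ne_of_follows htn ht htlt (hρ π)) ⟨π.1, π.2, rfl, hρ π⟩).1
  have hpk : ∀ π, sub (d (π.1 0)) (pk π) = (τ, ρ π) := fun π =>
    (e (π.1 0) (ρ π) (π.2.ne_of_follows htn ht htlt (hρ π)) ⟨π.1, π.2, rfl, hρ π⟩).2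
  -- Frees `pk` from the chosen indices `π 0` and `ρ π`, so that labels of different seatings can be
  -- compared inside a single bijection.
  have hpk' : ∀ π j ρ' (hj) (hx : IsTableOrder D t π.1 ∧ π.1 0 = j ∧ Follows ρ' π.1),
      pk π = (e j ρ' hj ⟨π.1, hx⟩).1 := by
    rintro π j ρ' hj ⟨h1, rfl, h3⟩
    obtain rfl : ρ π = ρ' := π.2.eq_of_follows htlt (hρ π) h3
    rfl
  refine ⟨pk, fun π => ⟨ρ π, hρ π, hpk π⟩, fun π π' h0 h => ?_, fun j p hj hτ => ?_⟩
  · have h1 := hpk π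
    rw [h0, h, hpk π'] at h1
    have h2 : ρ π' = ρ π := (Prod.ext_iff.1 h1).2
    have hj := π.2.ne_of_follows htn ht htlt (hρ π)
    rw [hpk' π (π.1 0) (ρ π) hj ⟨π.2, rfl, hρ π⟩,
      hpk' π' (π.1 0) (ρ π) hj ⟨π'.2, h0.symm, h2 ▸ hρ π'⟩] at h
    have h3 := (e (π.1 0) (ρ π) hj).injective (Subtype.ext h)
    exact Subtype.ext (congrArg (fun z => z.1) h3)
  · let x := (e j (sub (d j) p).2 hj).symm ⟨p, by rw [← hτ]⟩
    refine ⟨⟨x.1, x.2.1⟩, x.2.2.1, ?_⟩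
    rw [hpk' ⟨x.1, x.2.1⟩ j _ hj x.2]
    simp [x]

/-! ### Beamforming and decoding in one block -/

/-- The gain with which packet `w` is received at receiver `j`. -/
noncomputable def gain {KT KR N F : ℕ} (h : Fin KR → Fin KT → ℂ) (C : CachePlacement KT KR N F)
    (coef : Fin KT → Packet N F → ℂ) (j : Fin KR) (w : Packet N F) : ℂ :=
  ∑ i with w ∈ C.tx i, h j i * coef i w

theorem rxSignal_eq_sum_gain {KT KR N F l : ℕ} (h : Fin KR → Fin KT → ℂ)
    (C : CachePlacement KT KR N F) (P : Finset (Packet N F)) (coef : Fin KT → Packet N F → ℂ)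
    (coded : Packet N F → Fin l → ℂ) (noise : Fin l → ℂ) (j : Fin KR) :
    rxSignal h C P coef coded noise j = ∑ w ∈ P, gain h C coef j w • coded w + noise := by
  unfold rxSignal txSignal gain
  congr 1
  simp only [Finset.smul_sum, Finset.sum_smul, smul_smul]
  simp only [Finset.inter_comm _ P, ← Finset.filter_mem_eq_inter, Finset.sum_filter]
  exact Finset.sum_comm

/-- A receiver decodes when the packets that it has not cached are received with gain zero,
except for the desired packet, which is received with gain one. -/
theorem exists_decoding {KT KR N F : ℕ} {h : Fin KR → Fin KT → ℂ}
    {C : CachePlacement KT KR N F} {P : Finset (Packet N F)} {coef : Fin KT → Packet N F → ℂ}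
    {j : Fin KR} {w₀ : Packet N F} (hP : w₀ ∈ P) (hrx : w₀ ∉ C.rx j)
    (hgain : ∀ w ∈ P, w ∉ C.rx j → gain h C coef j w = if w = w₀ then 1 else 0) :
    ∃ (a : ℂ) (b : Packet N F → ℂ),
      ∀ (l : ℕ) (coded : Packet N F → Fin l → ℂ) (noise : Fin l → ℂ),
        a • rxSignal h C P coef coded noise j + ∑ w ∈ C.rx j, b w • coded w
          = coded w₀ + noise := by
  -- The received signal needs no rescaling; the cached interference is subtracted with its gain.
  refine ⟨1, fun w => if w ∈ P then -gain h C coef j w else 0, fun l coded noise => ?_⟩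
  rw [one_smul, rxSignal_eq_sum_gain]
  have h1 : ∑ w ∈ C.rx j, (if w ∈ P then -gain h C coef j w else 0) • coded w =
      -∑ w ∈ P with w ∈ C.rx j, gain h C coef j w • coded w := by
    rw [← Finset.sum_neg_distrib, Finset.filter_mem_eq_inter, Finset.inter_comm,
      ← Finset.filter_mem_eq_inter, Finset.sum_filter]
    refine Finset.sum_congr rfl fun w _ => ?_
    split_ifs <;> simp
  have h2 : ∑ w ∈ P with w ∉ C.rx j, gain h C coef j w • coded w = coded w₀ := by
    rw [Finset.sum_eq_single w₀]
    · rw [hgain w₀ hP hrx, if_pos rfl, one_smul]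
    · intro w hw hne
      rw [Finset.mem_filter] at hw
      rw [hgain w hw.1 hw.2, if_neg hne, zero_smul]
    · intro hw
      exact absurd (Finset.mem_filter.2 ⟨hP, hrx⟩) hw
  rw [h1, ← Finset.sum_filter_add_sum_filter_not P (· ∈ C.rx j), h2]
  abel

section block
variable {N F DT D t δ : ℕ} [NeZero (δ * t + t)]
  {C : CachePlacement (DT * (δ * t)) (D * t) N F}
  {sub : Fin N → Fin F →
    LatticePoint (DT * (δ * t)) DT (δ * t) × LatticePoint (D * t) D t}
  {π : Fin (δ * t + t) → Fin (D * t)} {d : Fin (D * t) → Fin N}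
  {τ : LatticePoint (DT * (δ * t)) DT (δ * t)} {pkt : Fin (δ * t + t) → Fin F}

theorem apply_stepAround {n : ℕ} [NeZero n] {α : Type*} (π : Fin n → α) (x : Fin n) (k : ℕ) :
    π (stepAround x k) = rotate π x (Fin.ofNat n k) := by
  rw [rotate_ofNat, Nat.add_comm]
  rfl

theorem mem_rx_stepAround_iff (ht : 0 < t) (hδ : 0 < δ)
    (hrx : ∀ j w, w ∈ C.rx j ↔ ∃ a, ((sub w.1 w.2).2 a : Fin (D * t)) = j)
    (hπ : IsTableOrder D t π)
    (hp : ∀ x : Fin (δ * t + t), ∃ ρ, Follows ρ (rotate π x) ∧ sub (d (π x)) (pkt x) = (τ, ρ))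
    (x : Fin (δ * t + t)) {k : ℕ} (hk : k < δ * t + t) :
    (d (π x), pkt x) ∈ C.rx (π (stepAround x k)) ↔ 1 ≤ k ∧ k ≤ t := by
  have htn : t ∣ δ * t + t := ⟨δ + 1, by ring⟩
  have htlt : t < δ * t + t := by
    have : 0 < δ * t := Nat.mul_pos hδ ht
    omega
  obtain ⟨ρ, hρ, hs⟩ := hp x
  rw [hrx, hs, apply_stepAround π x k]
  exact (hπ.rotate htn x).mem_iff_of_follows htn ht htlt hρ hk

/-- Even when demanded files coincide, the packet determines `ρ`, and `ρ` determines the place that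
it follows. -/
theorem packet_injective (ht : 0 < t) (hδ : 0 < δ) (hπ : IsTableOrder D t π)
    (hp : ∀ x : Fin (δ * t + t), ∃ ρ, Follows ρ (rotate π x) ∧ sub (d (π x)) (pkt x) = (τ, ρ)) :
    Function.Injective fun x => (d (π x), pkt x) := by
  have htn : t ∣ δ * t + t := ⟨δ + 1, by ring⟩
  have htlt : t < δ * t + t := by
    have : 0 < δ * t := Nat.mul_pos hδ ht
    omega
  intro x y hxy
  obtain ⟨h1, h2⟩ := Prod.ext_iff.1 hxy
  simp only at h1 h2
  obtain ⟨ρ, hρ, hs⟩ := hp x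
  obtain ⟨ρ', hρ', hs'⟩ := hp y
  rw [h1, h2, hs', Prod.mk.injEq] at hs
  obtain rfl := hs.2
  exact hπ.eq_of_follows_rotate htn ht htlt hρ hρ'

theorem exists_coef (ht : 0 < t) (hδ : 0 < δ) {h : Fin (D * t) → Fin (DT * (δ * t)) → ℂ}
    (hh : ∀ (e : Fin (δ * t) ↪ Fin (D * t)) (f : Fin (δ * t) ↪ Fin (DT * (δ * t))),
      (Matrix.of fun a b => h (e a) (f b)).det ≠ 0)
    (htx : ∀ i w, w ∈ C.tx i ↔ ∃ a, ((sub w.1 w.2).1 a : Fin (DT * (δ * t))) = i)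
    (hπ : IsTableOrder D t π)
    (hp : ∀ x : Fin (δ * t + t), ∃ ρ, Follows ρ (rotate π x) ∧ sub (d (π x)) (pkt x) = (τ, ρ)) :
    ∃ coef : Fin (DT * (δ * t)) → Packet N F → ℂ, ∀ x,
      gain h C coef (π x) (d (π x), pkt x) = 1 ∧
      ∀ k, t < k → k < δ * t + t →
        gain h C coef (π (stepAround x k)) (d (π x), pkt x) = 0 := by
  have hdt : 0 < δ * t := Nat.mul_pos hδ ht
  have hw := packet_injective ht hδ hπ hp
  let f : Fin (δ * t) ↪ Fin (DT * (δ * t)) := ⟨fun a => τ a, fun a b hab => by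
    have hab' : (τ a : Fin (DT * (δ * t))) = τ b := hab
    ext
    rw [← (τ a).2, ← (τ b).2, hab']⟩
  -- The `δ * t` places where the gain is prescribed, counted from `x`: the intended receiver, then
  -- `t + 1, …, t + δ * t - 1`. The places `1, …, t` in between cache the packet.
  let s : Fin (δ * t) → ℕ := fun a => if (a : ℕ) = 0 then 0 else t + a
  have hs : ∀ a, s a < δ * t + t := fun a => by
    simp only [s]
    split_ifs <;> omega
  have hsinj : ∀ a b, s a = s b → a = b := fun a b hab => by
    simp only [s] at hab
    ext
    split_ifs at hab <;> omega
  have hc : ∀ x : Fin (δ * t + t), ∃ c : Fin (DT * (δ * t)) → ℂ,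
      (∀ i, i ∉ Set.range f → c i = 0) ∧
      ∀ a, ∑ i, h (π (stepAround x (s a))) i * c i = if a = ⟨0, hdt⟩ then 1 else 0 := by
    intro x
    have hinj : Function.Injective fun a => π (stepAround x (s a)) := by
      intro a b hab
      have h1 := (hπ.ofNat_inj _ _).1 hab
      rw [Nat.add_comm, Nat.add_comm _ (s b), modEq_add_right_cancel_iff,
        Nat.mod_eq_of_lt (hs a), Nat.mod_eq_of_lt (hs b)] at h1
      exact hsinj a b h1
    exact exists_zeroForcing _ f (hh ⟨_, hinj⟩ f) ⟨0, hdt⟩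
  choose c hc0 hc1 using hc
  let coef : Fin (DT * (δ * t)) → Packet N F → ℂ := fun i w =>
    Function.extend (fun x => (d (π x), pkt x)) c 0 w i
  have hcoef : ∀ x i, coef i (d (π x), pkt x) = c x i := fun x i =>
    congrFun (hw.extend_apply c 0 x) i
  have hgain : ∀ x j, gain h C coef j (d (π x), pkt x) = ∑ i, h j i * c x i := by
    intro x j
    unfold gain
    -- `c x` vanishes off `τ`, and the transmitters of `τ` all cache the packet, so restricting the
    -- sum to caching transmitters loses nothing.
    rw [Finset.sum_filter_of_ne]
    · exact Finset.sum_congr rfl fun i _ => by rw [hcoef]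
    · intro i _ hne
      rw [hcoef] at hne
      by_contra hi
      apply hne
      rw [hc0 x i, mul_zero]
      rintro ⟨a, rfl⟩
      obtain ⟨ρ, -, hs⟩ := hp x
      apply hi
      rw [htx, hs]
      exact ⟨a, rfl⟩
  refine ⟨coef, fun x => ⟨?_, fun k hk hkn => ?_⟩⟩
  · have h1 := hc1 x ⟨0, hdt⟩
    have hx : stepAround x 0 = x := by
      ext
      simp [stepAround, Nat.mod_eq_of_lt x.2]
    simp only [s, if_true, hx] at h1
    rw [hgain, h1]
  · have h1 := hc1 x ⟨k - t, by omega⟩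
    have hsk : s ⟨k - t, by omega⟩ = k := by
      simp only [s]
      split_ifs <;> omega
    rw [hsk, if_neg (by rw [Fin.mk.injEq]; omega)] at h1
    rw [hgain, h1]

/-! ### From blocks to a delivery scheme -/

theorem exists_stepAround_eq {n : ℕ} (x y : Fin n) : ∃ k < n, stepAround y k = x := by
  refine ⟨(x + (n - y)) % n, Nat.mod_lt _ x.pos, ?_⟩
  ext
  simp only [stepAround, Nat.add_mod_mod]
  rw [show (y : ℕ) + (x + (n - y)) = x + n by omega, Nat.add_mod_right, Nat.mod_eq_of_lt x.2]

end block

theorem exists_rotate_rotate_eq {α : Type*} {n : ℕ} [NeZero n] (π : Fin n → α) (x : Fin n) :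
    ∃ y : Fin n, rotate (rotate π x) y = π := by
  refine ⟨Fin.ofNat n (n - x), ?_⟩
  rw [rotate_rotate]
  apply rotate_of_dvd
  apply Nat.dvd_of_mod_eq_zero
  rw [Fin.val_ofNat, Nat.mod_add_mod, Nat.sub_add_cancel x.2.le, Nat.mod_self]

/-- A rotation of a seating of distinct nodes is determined by having its least node at
place `0`. -/
theorem rotate_eq_self_of_isLeast {K n : ℕ} [NeZero n] {π : Fin n → Fin K}
    (hinj : Function.Injective π) (hπ : ∀ x, π 0 ≤ π x) {k : ℕ}
    (hk : ∀ x, rotate π k 0 ≤ rotate π k x) : rotate π k = π := by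
  -- Place `n * k - k` of the rotation holds `π 0`, so `π 0` and the node at place `k` bound each
  -- other.
  have h1 := hk (Fin.ofNat n (n * k - k))
  have h0 : rotate π k 0 = π (Fin.ofNat n k) := by
    unfold rotate
    simp
  have hle : k ≤ n * k := Nat.le_mul_of_pos_left k (Nat.pos_of_ne_zero (NeZero.ne n))
  have hz : Fin.ofNat n (n * k) = 0 := by
    ext
    simp
  rw [rotate_ofNat, h0, Nat.sub_add_cancel hle, hz] at h1
  have h2 := hinj (le_antisymm h1 (hπ _))
  apply rotate_of_dvd
  have h3 := Fin.ext_iff.1 h2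
  simp only [Fin.val_ofNat, Fin.val_zero] at h3
  exact Nat.dvd_of_mod_eq_zero h3

/-- Place `r + t * c` receives node number `c` of dimension `r`. This provides at least one block,
as `H_pos` requires. -/
theorem exists_isTableOrder {D t δ : ℕ} (ht : 0 < t) (hD : δ + 1 ≤ D) :
    ∃ π : Fin (δ * t + t) → Fin (D * t), IsTableOrder D t π := by
  have hdiv : ∀ x : Fin (δ * t + t), (x : ℕ) / t < D := fun x => by
    refine lt_of_lt_of_le ?_ hD
    rw [Nat.div_lt_iff_lt_mul ht, Nat.add_mul, one_mul]
    exact x.2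
  have hlt : ∀ x : Fin (δ * t + t), D * ((x : ℕ) % t) + x / t < D * t := fun x => by
    have h1 := hdiv x
    have h2 : D * ((x : ℕ) % t + 1) ≤ D * t := Nat.mul_le_mul_left _ (Nat.mod_lt _ ht)
    rw [Nat.mul_add] at h2
    omega
  have hq : ∀ x : Fin (δ * t + t), (D * ((x : ℕ) % t) + x / t) / D = x % t := fun x => by
    rw [Nat.mul_add_div (by omega), Nat.div_eq_of_lt (hdiv x), add_zero]
  refine ⟨fun x => ⟨D * ((x : ℕ) % t) + x / t, hlt x⟩, fun x y hxy => ?_, fun x y => ?_⟩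
  · have h := Fin.ext_iff.1 hxy
    simp only at h
    have h1 := congrArg (· / D) h
    simp only [hq] at h1
    rw [h1] at h
    apply Fin.ext
    rw [← Nat.mod_add_div x t, ← Nat.mod_add_div y t, h1, Nat.add_left_cancel h]
  · simp only [hq]

/-- For a channel with invertible square submatrices, every hypercube placement with the right
subfile size has a delivery scheme along circular hypercube permutations. -/
theorem exists_deliveryScheme {N F DT D t δ : ℕ} (hDT : 0 < DT) (ht : 0 < t) (hδ : 0 < δ)
    (hD : δ + 1 ≤ D) {C : CachePlacement (DT * (δ * t)) (D * t) N F}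
    (hF : F = DT ^ (δ * t) * D ^ t * subfileSize D t δ) (hC : C.IsHypercube DT (δ * t) D t)
    {h : Fin (D * t) → Fin (DT * (δ * t)) → ℂ}
    (hh : ∀ (e : Fin (δ * t) ↪ Fin (D * t)) (f : Fin (δ * t) ↪ Fin (DT * (δ * t))),
      (Matrix.of fun a b => h (e a) (f b)).det ≠ 0)
    (d : Fin (D * t) → Fin N) :
    ∃ S : DeliveryScheme h C d, S.sumDoF = ((δ * t + t : ℕ) : ℝ) ∧
      S.IsCircularHypercube D (δ * t) t δ := by
  classical
  have htn : t ∣ δ * t + t := ⟨δ + 1, by ring⟩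
  have : NeZero (δ * t + t) := ⟨by omega⟩
  obtain ⟨sub, hsub, htx, hrx⟩ := hC
  have hs : ∀ m b, (Finset.univ.filter fun p => sub m p = b).card = subfileSize D t δ :=
    card_subfile (Nat.mul_pos (pow_pos hDT _) (pow_pos (by omega) _)) hF fun n b => by
      convert hsub n b
  choose pk hpk hpkinj hpksurj using exists_labelling ht hδ sub hs d
  let TO := {π : Fin (δ * t + t) → Fin (D * t) // IsTableOrder D t π}
  let LT := LatticePoint (DT * (δ * t)) DT (δ * t)
  let rot : TO → ℕ → TO := fun π k => ⟨rotate π.1 k, π.2.rotate htn k⟩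
  let pkt : LT × TO → Fin (δ * t + t) → Fin F := fun b x => pk b.1 (rot b.2 x)
  have hp : ∀ (b : LT × TO) (x : Fin (δ * t + t)),
      ∃ ρ, Follows ρ (rotate b.2.1 x) ∧ sub (d (b.2.1 x)) (pkt b x) = (b.1, ρ) := by
    intro b x
    obtain ⟨ρ, h1, h2⟩ := hpk b.1 (rot b.2 x)
    refine ⟨ρ, h1, ?_⟩
    rw [← h2]
    simp only [rot, rotate_apply_zero]
    rfl
  -- The blocks: each rotation class is represented by its seating with the least node at place `0`.
  let B := {b : LT × TO // ∀ x, b.2.1 0 ≤ b.2.1 x}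
  have hcanon : ∀ π : TO, ∃ x : Fin (δ * t + t), ∀ y, (rot π x).1 0 ≤ (rot π x).1 y := by
    intro π
    obtain ⟨x, hx⟩ := Finite.exists_min π.1
    refine ⟨x, fun y => ?_⟩
    simp only [rot, rotate_apply_zero]
    exact hx _
  have hB : Nonempty B := by
    obtain ⟨π, hπ⟩ := exists_isTableOrder ht hD
    have : Nonempty LT := by
      rw [← Fintype.card_pos_iff, card_latticePoint]
      exact pow_pos hDT _
    obtain ⟨x, hx⟩ := hcanon ⟨π, hπ⟩
    exact ⟨⟨(Classical.arbitrary LT, rot ⟨π, hπ⟩ x), hx⟩⟩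
  let e : Fin (Nat.card B) ≃ B := (Finite.equivFin B).symm
  have hw : ∀ b : LT × TO, Function.Injective fun x => (d (b.2.1 x), pkt b x) := fun b =>
    packet_injective ht hδ b.2.2 (hp b)
  have hmem : ∀ (b : LT × TO) (x : Fin (δ * t + t)) {k : ℕ}, k < δ * t + t →
      ((d (b.2.1 x), pkt b x) ∈ C.rx (b.2.1 (stepAround x k)) ↔ 1 ≤ k ∧ k ≤ t) :=
    fun b x k hk => mem_rx_stepAround_iff ht hδ hrx b.2.2 (hp b) x hk
  have hstep : ∀ x : Fin (δ * t + t), stepAround x 0 = x := fun x => by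
    ext
    simp [stepAround, Nat.mod_eq_of_lt x.2]
  have hself : ∀ (b : LT × TO) x, (d (b.2.1 x), pkt b x) ∉ C.rx (b.2.1 x) := by
    intro b x hx
    have h0 := hmem b x (k := 0) (by omega)
    rw [hstep] at h0
    have := h0.1 hx
    omega
  choose coef hcoef using fun b : LT × TO => exists_coef ht hδ hh htx b.2.2 (hp b)
  let req : LT × TO → Finset (Fin (D * t) × Fin F) := fun b =>
    Finset.univ.image fun x => (b.2.1 x, pkt b x)
  have hreqinj : ∀ b : LT × TO, Function.Injective fun x => (b.2.1 x, pkt b x) := fun b x y hxy =>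
    b.2.2.inj (Prod.ext_iff.1 hxy).1
  let S : DeliveryScheme h C d :=
    { H := Nat.card B
      H_pos := Nat.card_pos
      req := fun m => req (e m).1
      coef := fun m => coef (e m).1
      req_uncached := by
        intro m r hr
        obtain ⟨x, -, rfl⟩ := Finset.mem_image.1 hr
        exact hself _ x
      receiver_inj := by
        intro m r hr r' hr' hrr
        obtain ⟨x, -, rfl⟩ := Finset.mem_image.1 hr
        obtain ⟨y, -, rfl⟩ := Finset.mem_image.1 hr'
        rw [(e m).1.2.2.inj hrr]
      packet_inj := by
        intro m r hr r' hr' hrr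
        obtain ⟨x, -, rfl⟩ := Finset.mem_image.1 hr
        obtain ⟨y, -, rfl⟩ := Finset.mem_image.1 hr'
        rw [hw _ hrr]
      decodable := by
        intro m r hr
        have hr0 := hr
        obtain ⟨x, -, rfl⟩ := Finset.mem_image.1 hr
        refine exists_decoding (Finset.mem_image_of_mem _ hr0) (hself _ x) fun w hwP hwrx => ?_
        obtain ⟨r', hr', rfl⟩ := Finset.mem_image.1 hwP
        obtain ⟨y, -, rfl⟩ := Finset.mem_image.1 hr'
        obtain ⟨k, hk, hky⟩ := exists_stepAround_eq x y
        by_cases hxy : y = x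
        · subst hxy
          rw [if_pos rfl]
          exact (hcoef _ y).1
        · rw [if_neg fun hxy' => hxy (hw _ hxy')]
          have hk0 : k ≠ 0 := by
            rintro rfl
            exact hxy (by rw [← hky, hstep])
          simp only [← hky] at hwrx ⊢
          rw [hmem _ y hk] at hwrx
          exact (hcoef _ y).2 k (by omega) hk
      complete := by
        intro j p hjp
        have hj : ∀ a, ((sub (d j) p).2 a : Fin (D * t)) ≠ j := fun a ha =>
          hjp ((hrx _ _).2 ⟨a, ha⟩)
        -- The label of the missing packet is rotated to its canonical form; the receiver then sits
        -- at the place `y` that undoes the rotation.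
        obtain ⟨π, hπ0, hπp⟩ := hpksurj (sub (d j) p).1 j p hj rfl
        obtain ⟨x, hx⟩ := hcanon π
        obtain ⟨y, hy⟩ := exists_rotate_rotate_eq π.1 x
        refine ⟨e.symm ⟨((sub (d j) p).1, rot π x), hx⟩, ?_⟩
        rw [Equiv.apply_symm_apply]
        refine Finset.mem_image.2 ⟨y, Finset.mem_univ _, ?_⟩
        have h1 : rot (rot π x) y = π := Subtype.ext hy
        have h2 : (rot π x).1 y = j := by
          rw [← hπ0]
          exact (rotate_apply_zero _ y).symm.trans (congrFun hy 0)
        simp only [pkt, h1, h2, hπp] }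
  -- A request shared by two blocks determines `τ` and, by injectivity of the labelling, a common
  -- rotation; canonical seatings in one rotation class are equal.
  have hdisj : ∀ b b' : B, ∀ x y, b.1.2.1 x = b'.1.2.1 y → pkt b.1 x = pkt b'.1 y → b = b' := by
    rintro ⟨⟨τ, π⟩, hc⟩ ⟨⟨τ', π'⟩, hc'⟩ x y hxy hpp
    simp only at hxy hc hc'
    obtain ⟨ρ, -, h1⟩ := hp (τ, π) x
    obtain ⟨ρ', -, h1'⟩ := hp (τ', π') y
    simp only at h1 h1'
    rw [hxy, hpp, h1', Prod.mk.injEq] at h1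
    obtain rfl := h1.1
    have h2 : rot π x = rot π' y := hpkinj τ' _ _ (by
      simp only [rot, rotate_apply_zero]
      exact hxy) hpp
    have h3 : rotate π.1 x = rotate π'.1 y := congrArg Subtype.val h2
    obtain ⟨z, hz⟩ := exists_rotate_rotate_eq π.1 x
    rw [h3, rotate_rotate] at hz
    have h4 := rotate_eq_self_of_isLeast π'.2.inj hc' (k := z + y) (by rw [hz]; exact hc)
    have h5 : π = π' := Subtype.ext (hz.symm.trans h4)
    subst h5
    rfl
  refine ⟨S, ?_, ?_⟩
  · have hcard : (Finset.univ.biUnion S.req).card = S.H * (δ * t + t) := by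
      rw [Finset.card_biUnion]
      · rw [Finset.sum_congr rfl fun m _ => (Finset.card_image_of_injective _ (hreqinj (e m).1) :
          (S.req m).card = _)]
        simp
      · intro m _ m' _ hmm
        change Disjoint (S.req m) (S.req m')
        rw [Finset.disjoint_left]
        intro r hr hr'
        obtain ⟨x, -, rfl⟩ := Finset.mem_image.1 hr
        obtain ⟨y, -, hy⟩ := Finset.mem_image.1 hr'
        obtain ⟨hy1, hy2⟩ := Prod.ext_iff.1 hy
        exact hmm (e.injective (hdisj _ _ x y hy1.symm hy2.symm))
    have hH : (S.H : ℝ) ≠ 0 := Nat.cast_ne_zero.2 S.H_pos.ne'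
    rw [DeliveryScheme.sumDoF, hcard, Nat.cast_mul, mul_div_cancel_left₀ _ hH]
  · intro m
    refine ⟨(e m).1.2.1, pkt (e m).1, (e m).1.2.2.isHypercubePermutation, rfl,
      fun x k => ⟨fun hk hkt => ?_, fun hk hkn => ⟨?_, (hcoef _ x).2 k hk hkn⟩⟩⟩
    · have : 0 < δ * t := Nat.mul_pos hδ ht
      exact (hmem _ x (by omega)).2 ⟨hk, hkt⟩
    · rw [hmem _ x hkn]
      omega

theorem theorem1 (KT KR N DT DR tT tR δ : ℕ) (MT MR : ℝ)
    (hN : 0 < N) (hDT : 0 < DT) (htR : 0 < tR) (hδ : 0 < δ)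
    (hMT : (N : ℝ) / MT = DT) (hMR : (N : ℝ) / MR = DR)
    (hKT : KT = DT * tT) (hKR : KR = DR * tR)
    (hδt : tT = δ * tR) (hDR : δ + 1 ≤ DR)
    (hK : ((KT : ℝ) * MT + (KR : ℝ) * MR) / (N : ℝ) ≤ (KR : ℝ)) :
    ((KT : ℝ) * MT + (KR : ℝ) * MR) / (N : ℝ) = (tT : ℝ) + (tR : ℝ) ∧
    ∃ F : ℕ,
      (F : ℝ) = ((N : ℝ) / MT) ^ tT * ((N : ℝ) / MR) ^ tR
        * ((DR - 2).choose (δ - 1) : ℝ) * ((DR - 1).choose δ : ℝ) ^ (tR - 1)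
        * (((δ ! : ℕ) : ℝ) ^ tR / (δ : ℝ)) * (((tR - 1)! : ℕ) : ℝ) ∧
      (∃ C : CachePlacement KT KR N F, C.IsHypercube DT tT DR tR) ∧
      ∀ C : CachePlacement KT KR N F, C.IsHypercube DT tT DR tR →
        C.MemoryFeasible MT MR ∧
        ∀ᵐ h : Fin KR → Fin KT → ℂ,
          (∀ d : Fin KR → Fin N, ∃ S : DeliveryScheme h C d,
            S.sumDoF = ((KT : ℝ) * MT + (KR : ℝ) * MR) / (N : ℝ) ∧
            S.IsCircularHypercube DR tT tR δ) ∧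
          ENNReal.ofReal (((KT : ℝ) * MT + (KR : ℝ) * MR) / (N : ℝ))
            ≤ oneShotLinearSumDoF h C := by
  have hDT0 : (DT : ℝ) ≠ 0 := Nat.cast_ne_zero.2 hDT.ne'
  have hDR0 : (DR : ℝ) ≠ 0 := Nat.cast_ne_zero.2 (by omega)
  have hN0 : (N : ℝ) ≠ 0 := Nat.cast_ne_zero.2 hN.ne'
  have hcount : ∀ (K D t : ℕ) (M : ℝ), (D : ℝ) ≠ 0 → (N : ℝ) / M = D → K = D * t →
      (K : ℝ) * M = N * t := by
    intro K D t M hD hM hK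
    have hM0 : M ≠ 0 := by
      rintro rfl
      rw [div_zero] at hM
      exact hD hM.symm
    rw [div_eq_iff hM0] at hM
    rw [hK, hM]
    push_cast
    ring
  have hsum : ((KT : ℝ) * MT + (KR : ℝ) * MR) / (N : ℝ) = (tT : ℝ) + (tR : ℝ) := by
    rw [hcount KT DT tT MT hDT0 hMT hKT, hcount KR DR tR MR hDR0 hMR hKR, ← mul_add,
      mul_div_cancel_left₀ _ hN0]
  refine ⟨hsum, ?_⟩
  rw [hsum]
  clear hK hsum
  subst hKT hKR hδt
  refine ⟨DT ^ (δ * tR) * DR ^ tR * subfileSize DR tR δ, ?_, exists_isHypercube _ _ _ _ _ _,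
    fun C hC => ⟨memoryFeasible_of_isHypercube hDT (by omega) hMT hMR rfl hC, ?_⟩⟩
  · rw [hMT, hMR]
    push_cast
    rw [cast_subfileSize DR htR hδ]
    ring
  · filter_upwards [ae_submatrix_det_ne_zero (δ * tR) (DR * tR) (DT * (δ * tR))] with h hh
    have hS : ∀ d : Fin (DR * tR) → Fin N, ∃ S : DeliveryScheme h C d,
        S.sumDoF = ((δ * tR : ℕ) : ℝ) + (tR : ℝ) ∧ S.IsCircularHypercube DR (δ * tR) tR δ := by
      intro d
      rw [← Nat.cast_add]
      exact exists_deliveryScheme hDT htR hδ hDR rfl hC hh d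
    refine ⟨hS, le_iInf fun d => ?_⟩
    obtain ⟨S, hS1, -⟩ := hS d
    rw [← hS1]
    exact le_iSup (fun S : DeliveryScheme h C d => ENNReal.ofReal S.sumDoF) S
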